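/- Let $L:\mathbb{R}^{N}\to\mathbb{R}$ be convex and differentiable with $\beta$-Lipschitz gradient, let $R:\mathbb{R}^{N}\to(-\infty,+\infty]$ be proper, convex and lower semicontinuous, and suppose that $F=L+R$ is coercive. Let $0<\tau$ with $\tau\beta<1$. For $\epsilon\ge 0$ let $\partial_\epsilon f(z)=\{v : f(u)\ge f(z)+\langle u-z,v\rangle-\epsilon\ \ \forall u\in\mathbb{R}^N\}$, and say that $z$ is an approximation of $\mathrm{prox}_{\tau R}(w)$ with precision $\epsilon$ of Type 1 if $0\in\partial_\epsilon\big(R+\tfrac1{2\tau}\|\cdot-w\|^2\big)(z)$, and of Type 2 if $\tau^{-1}(w-z)\in\partial_\epsilon R(z)$; write $z\approx_{i,\epsilon}\mathrm{prox}_{\tau R}(w)$ for Type $i$. Let $(a,d)$ satisfy either $d=0$, $a>0$, or $d\in(0,1]$, $a>\max\{1,(2d)^{1/d}\}$; put $t_0=1$, $t_{k+1}=\left(\frac{k+a}{a}\right)^d$ and $\alpha_k=\frac{t_k-1}{t_{k+1}}$ for $k\ge 0$. Let $I_h^H:\mathbb{R}^{N}\to\mathbb{R}^{N_H}$ (restriction)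 and $I_H^h:\mathbb{R}^{N_H}\to\mathbb{R}^{N}$ (prolongation) be linear, and let $m,p\in\mathbb{N}$. Consider a run of IML FISTA from arbitrary $x_0,y_0\in\mathbb{R}^N$: for $k=0,1,2,\dots$, $$\bar y_k=\begin{cases} y_k+\bar\tau_k I_H^h(s_{k,m}-s_{k,0}) & \text{if a coarse correction is made at iteration } k,\\ y_k&\text{otherwise,}\end{cases}$$ $$x_{k+1}\approx_{i,\epsilon_k}\mathrm{prox}_{\tau R}\big(\bar y_k-\tau\nabla L(\bar y_k)\big),\qquad y_{k+1}=x_{k+1}+\alpha_k(x_{k+1}-x_k),$$ where $\bar\tau_k>0$, $s_{k,0}=I_h^Hy_k$, $s_{k,\ell+1}=\Phi_{k,\ell}(s_{k,\ell})$ for arbitrary maps $\Phi_{k,\ell}:\mathbb{R}^{N_H}\to\mathbb{R}^{N_H}$, and a coarse correction is made at iteration $k$ exactly when a given (arbitrary) descent condition holds at $k$ and fewer than $p$ corrections have been made before. Let the precisions satisfy $\epsilon_k\ge0$ and - $\sum_{k\ge1}k^{d}\sqrt{\epsilon_k}<+\infty$, if $i=1$ (Type 1 approximations), - $\sum_{k\ge1}k^{2d}\epsilon_k<+\infty$,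 if $i=2$ (Type 2 approximations). Then $F(x_k)<+\infty$ for all $k\ge1$; for every minimizer $x^*$ of $F$, the sequence $\big(k^{2d}(F(x_k)-F(x^*))\big)_{k\ge1}$ is bounded; and $(x_k)_{k\in\mathbb{N}}$ converges to a minimizer of $F$. -/

import Mathlib

open Filter Topology
open scoped NNReal ENNReal Gradient

/-- The Euclidean space `ℝ^n`. -/
abbrev Euc (n : ℕ) := EuclideanSpace ℝ (Fin n)

/-- Proper convex lower semicontinuous functions `ℝ^n → (-∞, +∞]`. -/
structure ProperConvexLsc {n : ℕ} (R : Euc n → EReal) : Prop where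
  ne_bot : ∀ x, R x ≠ ⊥
  exists_ne_top : ∃ x, R x ≠ ⊤
  convex : ∀ x y : Euc n, ∀ s t : ℝ, 0 < s → 0 < t → s + t = 1 →
    R (s • x + t • y) ≤ (s : EReal) * R x + (t : EReal) * R y
  lsc : LowerSemicontinuous R

/-- The objective function `F = L + R`. -/
noncomputable def objective {n : ℕ} (L : Euc n → ℝ) (R : Euc n → EReal) (x : Euc n) : EReal :=
  (L x : EReal) + R x

/-- `F (x) → +∞` as `‖x‖ → ∞`. -/
def Coercive {n : ℕ} (F : Euc n → EReal) : Prop :=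
  Tendsto F (Bornology.cobounded (Euc n)) (𝓝 ⊤)

/-- The set of minimizers of `F`. -/
def minimizers {n : ℕ} (F : Euc n → EReal) : Set (Euc n) :=
  {x | ∀ u, F x ≤ F u}

/-- The `ε`-subdifferential of `f` at `z`. -/
def epsSubdiff {n : ℕ} (f : Euc n → EReal) (ε : ℝ) (z : Euc n) : Set (Euc n) :=
  {v | ∀ x, f z + ((inner ℝ (x - z) v - ε : ℝ) : EReal) ≤ f x}

/-- `z` is a type 1 approximation of `prox_{γ R} (y)` with precision `ε`. -/
def IsProxApprox₁ {n : ℕ} (R : Euc n → EReal) (γ ε : ℝ) (y z : Euc n) : Prop :=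
  (0 : Euc n) ∈ epsSubdiff (fun u => R u + ((1 / (2 * γ) * ‖u - y‖ ^ 2 : ℝ) : EReal)) ε z

/-- `z` is a type 2 approximation of `prox_{γ R} (y)` with precision `ε`. -/
def IsProxApprox₂ {n : ℕ} (R : Euc n → EReal) (γ ε : ℝ) (y z : Euc n) : Prop :=
  γ⁻¹ • (y - z) ∈ epsSubdiff R ε z

/-- The admissible inertia parameters: `d = 0` (no inertia), or
`0 < d ≤ 1` and `a > max {1, (2d)^{1/d}}`. -/
def AdmissibleInertia (a d : ℝ) : Prop :=
  (d = 0 ∧ 0 < a) ∨ (0 < d ∧ d ≤ 1 ∧ max 1 ((2 * d) ^ (1 / d)) < a)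

/-- `t_0 = 1` and `t_{k+1} = ((k + a) / a)^d`. -/
noncomputable def inertiaT (a d : ℝ) : ℕ → ℝ
  | 0 => 1
  | k + 1 => (((k : ℝ) + a) / a) ^ d

/-- `α_k = (t_k - 1) / t_{k+1}`. -/
noncomputable def inertiaAlpha (a d : ℝ) (k : ℕ) : ℝ :=
  (inertiaT a d k - 1) / inertiaT a d (k + 1)

/-- The coarse iterates `s_ℓ`: start at `s₀` and apply `Φ_0, Φ_1, …` successively. -/
def coarseIterate {m : ℕ} (Φ : ℕ → Euc m → Euc m) (s₀ : Euc m) : ℕ → Euc m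
  | 0 => s₀
  | l + 1 => Φ l (coarseIterate Φ s₀ l)

open Classical in
/-- The counter `r`: the number of coarse corrections performed before iteration `k`, when
a correction is performed exactly if the descent condition holds and `r < p`. -/
noncomputable def correctionCount (descent : ℕ → Prop) (p : ℕ) : ℕ → ℕ
  | 0 => 0
  | k + 1 => if descent k ∧ correctionCount descent p k < p
      then correctionCount descent p k + 1 else correctionCount descent p k

/-- Iteration `k` performs a coarse correction. -/
def CoarseStep (descent : ℕ → Prop) (p k : ℕ) : Prop :=
  descent k ∧ correctionCount descent p k < p

/-- `(x, y, ybar)` is a run of IML FISTA. Here `approx ε w z` is the relation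
`z ≈_ε prox_{τ R} (w)` used in the forward-backward step, `Res` and `Pro` are the restriction
and the prolongation operator, `Φ k l` is the `l`-th coarse operator at the fine iteration `k`,
`m` is the number of coarse iterations, `τbar k` is the size of the coarse update, and
`descent k` says whether the descent condition holds at iteration `k` of the run. -/
structure IsIMLFISTA {n nH : ℕ} (L : Euc n → ℝ) (τ : ℝ)
    (approx : ℝ → Euc n → Euc n → Prop)
    (Res : Euc n →ₗ[ℝ] Euc nH) (Pro : Euc nH →ₗ[ℝ] Euc n)
    (Φ : ℕ → ℕ → Euc nH → Euc nH) (m : ℕ) (τbar : ℕ → ℝ)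
    (descent : ℕ → Prop) (p : ℕ) (a d : ℝ) (ε : ℕ → ℝ)
    (x y ybar : ℕ → Euc n) : Prop where
  tau_bar_pos : ∀ k, CoarseStep descent p k → 0 < τbar k
  coarse_step : ∀ k, CoarseStep descent p k →
    ybar k = y k + τbar k • Pro (coarseIterate (Φ k) (Res (y k)) m - Res (y k))
  standard_step : ∀ k, ¬ CoarseStep descent p k → ybar k = y k
  forward_backward : ∀ k, approx (ε k) (ybar k - τ • ∇ L (ybar k)) (x (k + 1))
  inertial : ∀ k, y (k + 1) = x (k + 1) + inertiaAlpha a d k • (x (k + 1) - x k)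

/-! At most `p` coarse corrections occur, so from some iteration on the run is plain inexact FISTA,
started from uncontrolled but fixed points. It therefore suffices to study such a tail.

Both types of approximation give a subgradient inequality at `x (k + 1)` with error `δ k * ‖v - x (k
+ 1)‖ + η k`: Type 1 has `δ` of order `√ε` and `η = 2ε`, Type 2 has `δ = 0` and `η = ε`. With the
descent lemma and `τβ < 1` this becomes the one-step inequality `forward_backward_ineq`. The tail is
then an `InexactInertialScheme` for `f = 2τF`, with growth constant `c = 1 - 2d / a ^ d > 0`.

Three choices of test point `v` do the work. A convex combination of the current iterate and a
minimizer makes a Lyapunov energy almost decrease (`energy_succ_le`); a discrete Bihari argument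
bounds it, which gives the rate, and the surplus from `c` makes `T * gap` summable. The current
iterate itself gives `∑ T n * ‖X (n + 1) - X n‖ ^ 2 < ∞` (`summable_velocity`). A minimizer `s`
shows that `‖X n - s‖` converges (`exists_tendsto_norm_sub`). Opial's argument
(`exists_tendsto_minimizer`) concludes; coercivity serves only to provide a minimizer. -/

/-! ### Convex functions with Lipschitz gradient. -/

section Smooth

variable {E : Type*} [NormedAddCommGroup E] [InnerProductSpace ℝ E] [CompleteSpace E]

theorem hasDerivAt_comp_line {L : E → ℝ} (hL : Differentiable ℝ L) (y h : E) (t : ℝ) :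
    HasDerivAt (fun t : ℝ => L (y + t • h)) (inner ℝ (∇ L (y + t • h)) h) t := by
  have h1 := (hL (y + t • h)).hasGradientAt.hasFDerivAt
  have h2 : HasDerivAt (fun t : ℝ => y + t • h) h t := by
    simpa using ((hasDerivAt_id t).smul_const h).const_add y
  exact h1.comp_hasDerivAt t h2

/-- A convex differentiable function lies above its tangent planes. -/
theorem ConvexOn.add_inner_gradient_le {L : E → ℝ} (hc : ConvexOn ℝ Set.univ L)
    (hL : Differentiable ℝ L) (y u : E) : L y + inner ℝ (∇ L y) (u - y) ≤ L u := by
  have hline : ConvexOn ℝ Set.univ (fun t : ℝ => L (y + t • (u - y))) := by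
    have := hc.comp_affineMap (AffineMap.lineMap (k := ℝ) y u)
    have e : (L ∘ (AffineMap.lineMap (k := ℝ) y u)) = fun t : ℝ => L (y + t • (u - y)) := by
      funext t
      simp [AffineMap.lineMap_apply, add_comm]
    rwa [e, Set.preimage_univ] at this
  have h := hline.le_slope_of_hasDerivAt (Set.mem_univ (0 : ℝ)) (Set.mem_univ (1 : ℝ)) one_pos
    (hasDerivAt_comp_line hL y (u - y) 0)
  simp only [slope_def_field, zero_smul, add_zero, one_smul, sub_zero, div_one,
    add_sub_cancel] at h
  linarith

/-- The descent lemma for functions with Lipschitz gradient. -/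
theorem le_add_inner_gradient_add_sq {L : E → ℝ} {β : ℝ≥0} (hL : Differentiable ℝ L)
    (hlip : LipschitzWith β (∇ L)) (y z : E) :
    L z ≤ L y + inner ℝ (∇ L y) (z - y) + β / 2 * ‖z - y‖ ^ 2 := by
  set h := z - y with hh
  let ψ : ℝ → ℝ := fun t => L (y + t • h) - t * inner ℝ (∇ L y) h - β / 2 * ‖h‖ ^ 2 * t ^ 2
  have hder : ∀ t : ℝ, HasDerivAt ψ
      (inner ℝ (∇ L (y + t • h)) h - inner ℝ (∇ L y) h - β / 2 * ‖h‖ ^ 2 * (2 * t)) t := by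
    intro t
    have h1 := hasDerivAt_comp_line hL y h t
    have h2 := (hasDerivAt_id t).mul_const (inner ℝ (∇ L y) h)
    have h3 := ((hasDerivAt_id t).pow 2).const_mul (β / 2 * ‖h‖ ^ 2)
    refine ((h1.sub h2).sub h3).congr_deriv ?_
    simp
  have hanti : AntitoneOn ψ (Set.Icc 0 1) := by
    refine antitoneOn_of_deriv_nonpos (convex_Icc 0 1)
      (fun t _ => (hder t).continuousAt.continuousWithinAt)
      (fun t _ => (hder t).differentiableAt.differentiableWithinAt) ?_
    intro t ht
    rw [interior_Icc] at ht
    rw [(hder t).deriv, ← inner_sub_left]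
    have h1 : inner ℝ (∇ L (y + t • h) - ∇ L y) h ≤ ‖∇ L (y + t • h) - ∇ L y‖ * ‖h‖ :=
      real_inner_le_norm _ _
    have h2 : ‖∇ L (y + t • h) - ∇ L y‖ ≤ β * (t * ‖h‖) := by
      have := hlip.norm_sub_le (y + t • h) y
      rwa [add_sub_cancel_left, norm_smul, Real.norm_of_nonneg ht.1.le] at this
    nlinarith [mul_le_mul_of_nonneg_right h2 (norm_nonneg h)]
  have h01 := hanti (Set.left_mem_Icc.2 zero_le_one) (Set.right_mem_Icc.2 zero_le_one) zero_le_one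
  have hz : y + h = z := by simp [hh]
  simp only [ψ, one_smul, zero_smul, hz, add_zero] at h01
  linarith

end Smooth

/-! ### Inexact proximal points and the one-step inequality. -/

section Prox

variable {n : ℕ} {R : Euc n → EReal}

theorem ProperConvexLsc.coe_toReal (hR : ProperConvexLsc R) {x : Euc n} (hx : R x ≠ ⊤) :
    ((R x).toReal : EReal) = R x :=
  EReal.coe_toReal hx (hR.ne_bot x)

theorem ProperConvexLsc.convexOn_toReal (hR : ProperConvexLsc R) :
    ConvexOn ℝ {x | R x ≠ ⊤} (fun x => (R x).toReal) := by
  rw [convexOn_iff_forall_pos]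
  have key : ∀ x, R x ≠ ⊤ → ∀ y, R y ≠ ⊤ → ∀ s t : ℝ, 0 < s → 0 < t → s + t = 1 →
      R (s • x + t • y) ≤ ((s * (R x).toReal + t * (R y).toReal : ℝ) : EReal) := by
    intro x hx y hy s t hs ht hst
    have := hR.convex x y s t hs ht hst
    rwa [← hR.coe_toReal hx, ← hR.coe_toReal hy, ← EReal.coe_mul, ← EReal.coe_mul,
      ← EReal.coe_add] at this
  have hdom : ∀ x, R x ≠ ⊤ → ∀ y, R y ≠ ⊤ → ∀ s t : ℝ, 0 < s → 0 < t → s + t = 1 →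
      R (s • x + t • y) ≠ ⊤ := fun x hx y hy s t hs ht hst =>
    ((key x hx y hy s t hs ht hst).trans_lt (EReal.coe_lt_top _)).ne
  refine ⟨convex_iff_forall_pos.2 fun x hx y hy s t hs ht hst => hdom x hx y hy s t hs ht hst, ?_⟩
  intro x hx y hy s t hs ht hst
  have := key x hx y hy s t hs ht hst
  rw [← hR.coe_toReal (hdom x hx y hy s t hs ht hst), EReal.coe_le_coe_iff] at this
  simpa using this

theorem IsProxApprox₂.ne_top (hR : ProperConvexLsc R) {γ ε : ℝ} {w z : Euc n}
    (h : IsProxApprox₂ R γ ε w z) : R z ≠ ⊤ := by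
  obtain ⟨u, hu⟩ := hR.exists_ne_top
  intro hz
  have := h u
  rw [hz, EReal.top_add_coe] at this
  exact hu (top_le_iff.1 this)

theorem IsProxApprox₁.ne_top (hR : ProperConvexLsc R) {γ ε : ℝ} {w z : Euc n}
    (h : IsProxApprox₁ R γ ε w z) : R z ≠ ⊤ := by
  obtain ⟨u, hu⟩ := hR.exists_ne_top
  intro hz
  have := h u
  dsimp only at this
  rw [hz, EReal.top_add_coe, EReal.top_add_coe, ← hR.coe_toReal hu, ← EReal.coe_add] at this
  exact EReal.coe_ne_top _ (top_le_iff.1 this)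

theorem IsProxApprox₂.subgradient_ineq (hR : ProperConvexLsc R) {γ ε : ℝ} {w z : Euc n}
    (h : IsProxApprox₂ R γ ε w z) {v : Euc n} (hv : R v ≠ ⊤) :
    (R z).toReal + γ⁻¹ * inner ℝ (v - z) (w - z) ≤ (R v).toReal + ε := by
  have := h v
  rw [← hR.coe_toReal (h.ne_top hR), ← hR.coe_toReal hv, ← EReal.coe_add,
    EReal.coe_le_coe_iff, real_inner_smul_right] at this
  linarith

theorem IsProxApprox₁.near_min (hR : ProperConvexLsc R) {γ ε : ℝ} {w z : Euc n}
    (h : IsProxApprox₁ R γ ε w z) {v : Euc n} (hv : R v ≠ ⊤) :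
    (R z).toReal + 1 / (2 * γ) * ‖z - w‖ ^ 2 ≤
      (R v).toReal + 1 / (2 * γ) * ‖v - w‖ ^ 2 + ε := by
  have := h v
  dsimp only at this
  rw [← hR.coe_toReal (h.ne_top hR), ← hR.coe_toReal hv, ← EReal.coe_add, ← EReal.coe_add,
    ← EReal.coe_add, EReal.coe_le_coe_iff, inner_zero_right] at this
  linarith

/-- Type 1 approximate proximal points satisfy a subgradient inequality up to an error which is
affine in the distance. -/
theorem IsProxApprox₁.subgradient_ineq (hR : ProperConvexLsc R) {γ ε : ℝ} (hγ : 0 < γ)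
    (hε : 0 ≤ ε) {w z : Euc n} (h : IsProxApprox₁ R γ ε w z) {v : Euc n} (hv : R v ≠ ⊤) :
    (R z).toReal + γ⁻¹ * inner ℝ (v - z) (w - z) ≤
      (R v).toReal + √(2 / γ) * √ε * ‖v - z‖ + 2 * ε := by
  have hz := h.ne_top hR
  -- Near-minimality is tested at `(1 - l) • z + l • v`. After division by `l` the error is `l /
  -- (2γ) * ‖v - z‖ ^ 2 + ε / l`, to be optimized over `l ∈ (0, 1]`.
  have seg : ∀ l : ℝ, 0 < l → l ≤ 1 →
      l * ((R z).toReal + γ⁻¹ * inner ℝ (v - z) (w - z)) ≤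
        l * (R v).toReal + l ^ 2 * (1 / (2 * γ)) * ‖v - z‖ ^ 2 + ε := by
    intro l hl hl1
    have hmem := hR.convexOn_toReal.1 hz hv (sub_nonneg.2 hl1) hl.le (by ring)
    have hcv := hR.convexOn_toReal.2 hz hv (sub_nonneg.2 hl1) hl.le (by ring)
    have hm := h.near_min hR hmem
    have e : (1 - l) • z + l • v - w = l • (v - z) - (w - z) := by module
    have e2 : ‖z - w‖ = ‖w - z‖ := norm_sub_rev _ _
    rw [e, e2, norm_sub_sq_real (l • (v - z)), norm_smul, Real.norm_of_nonneg hl.le,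
      real_inner_smul_left] at hm
    simp only [smul_eq_mul] at hcv
    have e3 : 1 / (2 * γ) * ((l * ‖v - z‖) ^ 2 - 2 * (l * inner ℝ (v - z) (w - z)) + ‖w - z‖ ^ 2)
        = l ^ 2 * (1 / (2 * γ)) * ‖v - z‖ ^ 2 - l * (γ⁻¹ * inner ℝ (v - z) (w - z))
          + 1 / (2 * γ) * ‖w - z‖ ^ 2 := by
      field_simp
    rw [e3] at hm
    linarith
  have hq : √(2 / γ) * √ε = 2 * √(ε / (2 * γ)) := by
    rw [← Real.sqrt_mul (by positivity)]
    have : 2 / γ * ε = 2 ^ 2 * (ε / (2 * γ)) := by field_simp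
    rw [this, Real.sqrt_mul (by positivity), Real.sqrt_sq (by norm_num)]
  have hκ : 0 ≤ √(2 / γ) * √ε * ‖v - z‖ := by positivity
  -- The unconstrained optimum is `l = √(2γε) / ‖v - z‖`. If it is at least 1, or undefined because
  -- `v = z`, then `l = 1` costs at most `2ε`; for `ε = 0` it degenerates to the limit `l → 0`.
  by_cases hcase : ‖v - z‖ ^ 2 ≤ 2 * γ * ε
  · have h1 := seg 1 one_pos le_rfl
    have : 1 / (2 * γ) * ‖v - z‖ ^ 2 ≤ ε := by
      rw [one_div, inv_mul_le_iff₀ (by positivity)]; exact hcase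
    nlinarith
  · push Not at hcase
    have hN : 0 < ‖v - z‖ := by
      by_contra hN
      have : ‖v - z‖ = 0 := le_antisymm (not_lt.1 hN) (norm_nonneg _)
      rw [this] at hcase
      have : 0 ≤ 2 * γ * ε := by positivity
      linarith
    rcases hε.eq_or_lt with rfl | hε'
    · have h0 : ∀ l : ℝ, 0 < l → l ≤ 1 →
          (R z).toReal + γ⁻¹ * inner ℝ (v - z) (w - z) ≤
            (R v).toReal + l * ((1 / (2 * γ)) * ‖v - z‖ ^ 2) := by
        intro l hl hl1
        have := seg l hl hl1
        refine le_of_mul_le_mul_left ?_ hl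
        linarith
      have hlim : Tendsto (fun l : ℝ => (R v).toReal + l * ((1 / (2 * γ)) * ‖v - z‖ ^ 2))
          (𝓝[>] 0) (𝓝 ((R v).toReal + 0 * ((1 / (2 * γ)) * ‖v - z‖ ^ 2))) :=
        ((tendsto_id.mul_const _).const_add _).mono_left nhdsWithin_le_nhds
      have hle := ge_of_tendsto hlim (by
        filter_upwards [Ioc_mem_nhdsGT (zero_lt_one' ℝ)] with l hl using h0 l hl.1 hl.2)
      simpa using hle
    · set q := √(ε / (2 * γ)) with hqdef
      have hq0 : 0 < q := Real.sqrt_pos.2 (by positivity)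
      have hq2 : q ^ 2 = ε / (2 * γ) := Real.sq_sqrt (by positivity)
      have hεq : ε = 2 * γ * q ^ 2 := by rw [hq2]; field_simp
      set l := 2 * γ * q / ‖v - z‖ with hl
      have hl0 : 0 < l := by positivity
      have hl1 : l ≤ 1 := by
        rw [hl, div_le_one hN]
        refine le_of_sq_le_sq ?_ hN.le
        calc (2 * γ * q) ^ 2 = 2 * γ * ε := by rw [hεq]; ring
          _ ≤ _ := hcase.le
      have hs := seg l hl0 hl1
      have e4 : l ^ 2 * (1 / (2 * γ)) * ‖v - z‖ ^ 2 + ε = l * (2 * q * ‖v - z‖) := by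
        rw [hεq, hl]; field_simp; ring
      rw [hq]
      have : (R z).toReal + γ⁻¹ * inner ℝ (v - z) (w - z) ≤ (R v).toReal + 2 * q * ‖v - z‖ := by
        refine le_of_mul_le_mul_left ?_ hl0
        linarith
      linarith

/-- The forward-backward inequality with errors. -/
theorem forward_backward_ineq {L : Euc n → ℝ} {β : ℝ≥0} {τ : ℝ}
    (hL_conv : ConvexOn ℝ Set.univ L) (hL_diff : Differentiable ℝ L)
    (hL_lip : LipschitzWith β (∇ L)) (hτ : 0 < τ) (hτβ : τ * β < 1) {y z v : Euc n} {δ η : ℝ}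
    (h : (R z).toReal + τ⁻¹ * inner ℝ (v - z) (y - τ • ∇ L y - z) ≤
      (R v).toReal + δ * ‖v - z‖ + η) :
    2 * τ * (L z + (R z).toReal) + ‖v - z‖ ^ 2 ≤
      2 * τ * (L v + (R v).toReal) + ‖v - y‖ ^ 2 + 2 * τ * δ * ‖v - z‖ + 2 * τ * η := by
  have h1 := hL_conv.add_inner_gradient_le hL_diff y v
  have h2 := le_add_inner_gradient_add_sq hL_diff hL_lip y z
  have e1 : y - τ • ∇ L y - z = (y - z) - τ • ∇ L y := by abel
  rw [e1, inner_sub_right, real_inner_smul_right] at h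
  have e2 : inner ℝ (∇ L y) (v - y) - inner ℝ (∇ L y) (z - y) = inner ℝ (v - z) (∇ L y) := by
    rw [← inner_sub_right, real_inner_comm]; congr 1; abel
  have e3 : ‖v - y‖ ^ 2 = ‖v - z‖ ^ 2 - 2 * inner ℝ (v - z) (y - z) + ‖z - y‖ ^ 2 := by
    rw [norm_sub_rev z y, ← norm_sub_sq_real]; congr 2; abel
  have h' : τ * ((R z).toReal + τ⁻¹ * (inner ℝ (v - z) (y - z) - τ * inner ℝ (v - z) (∇ L y))) =
      τ * (R z).toReal + inner ℝ (v - z) (y - z) - τ * inner ℝ (v - z) (∇ L y) := by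
    field_simp
    ring
  have h3 := mul_le_mul_of_nonneg_left h hτ.le
  rw [h'] at h3
  have h4 : L z ≤ L v - inner ℝ (v - z) (∇ L y) + β / 2 * ‖z - y‖ ^ 2 := by linarith
  have h5 := mul_le_mul_of_nonneg_left h4 hτ.le
  -- The polarization identity `e3` supplies a full `‖z - y‖ ^ 2`, which pays for the quadratic
  -- error of the descent lemma.
  have h6 : τ * β * ‖z - y‖ ^ 2 ≤ 1 * ‖z - y‖ ^ 2 :=
    mul_le_mul_of_nonneg_right hτβ.le (sq_nonneg _)
  nlinarith

end Prox

/-! ### Almost decreasing real sequences. -/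

section RealSequences

theorem summable_and_bounded_of_le_add {E p c : ℕ → ℝ} (hE : ∀ n, 0 ≤ E n) (hp : ∀ n, 0 ≤ p n)
    (hc : ∀ n, 0 ≤ c n) (hcs : Summable c) (h : ∀ n, E (n + 1) + p n ≤ E n + c n) :
    Summable p ∧ ∀ n, E n ≤ E 0 + ∑' i, c i := by
  have key : ∀ n, E n + ∑ i ∈ Finset.range n, p i ≤ E 0 + ∑ i ∈ Finset.range n, c i := by
    intro n
    induction n with
    | zero => simp
    | succ n ih =>
      rw [Finset.sum_range_succ, Finset.sum_range_succ]
      linarith [h n]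
  have hle : ∀ n, ∑ i ∈ Finset.range n, c i ≤ ∑' i, c i := fun n =>
    hcs.sum_le_tsum _ fun i _ => hc i
  refine ⟨summable_of_sum_range_le hp fun n => (?_ : _ ≤ E 0 + ∑' i, c i), fun n => ?_⟩
  · linarith [key n, hle n, hE n]
  · linarith [key n, hle n, Finset.sum_nonneg fun i (_ : i ∈ Finset.range n) => hp i]

/-- A discrete Bihari-type inequality. -/
theorem bounded_of_le_add_mul_sqrt {E r b c : ℕ → ℝ} (hr : ∀ n, 0 ≤ r n)
    (hrE : ∀ n, r n ^ 2 ≤ E n) (hb : ∀ n, 0 ≤ b n) (hc : ∀ n, 0 ≤ c n)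
    (hbs : Summable b) (hcs : Summable c)
    (h : ∀ n, E (n + 1) ≤ E n + b n * r (n + 1) + c n) :
    ∃ M, 0 ≤ M ∧ ∀ n, r n ≤ M := by
  set A := E 0 + ∑' i, c i with hA
  set B := ∑' i, b i with hB
  have hA0 : 0 ≤ A := add_nonneg ((sq_nonneg _).trans (hrE 0)) (tsum_nonneg hc)
  have hB0 : 0 ≤ B := tsum_nonneg hb
  have hE0 : E 0 ≤ A := le_add_of_nonneg_right (tsum_nonneg hc)
  have sum_b : ∀ n, ∑ i ∈ Finset.range n, b i ≤ B := fun n => hbs.sum_le_tsum _ fun i _ => hb i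
  have sum_c : ∀ n, ∑ i ∈ Finset.range n, c i ≤ ∑' i, c i := fun n =>
    hcs.sum_le_tsum _ fun i _ => hc i
  have quad : ∀ s : ℝ, s ^ 2 ≤ A + B * s → s ≤ A + B + 1 := by
    intro s hs
    by_contra! hlt
    nlinarith [mul_nonneg hA0 (by linarith : (0 : ℝ) ≤ s - 1)]
  have unroll : ∀ n (M : ℝ), (∀ i ≤ n, r i ≤ M) →
      E n ≤ E 0 + (∑ i ∈ Finset.range n, b i) * M + ∑ i ∈ Finset.range n, c i := by
    intro n M
    induction n with
    | zero => intro _; simp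
    | succ n ih =>
      intro hM
      have h1 := ih fun i hi => hM i (hi.trans n.le_succ)
      have h2 := mul_le_mul_of_nonneg_left (hM (n + 1) le_rfl) (hb n)
      rw [Finset.sum_range_succ, Finset.sum_range_succ]
      linarith [h n]
  refine ⟨A + B + 1, by linarith, fun n => ?_⟩
  induction n using Nat.strong_induction_on with
  | _ n ih =>
    -- At a first violation `r n` is the running maximum, so every `r i` in the unrolled recursion
    -- may be replaced by it; this gives `r n ^ 2 ≤ A + B * r n`.
    by_contra! hlt
    have hall : ∀ i ≤ n, r i ≤ r n := fun i hi => by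
      rcases hi.lt_or_eq with hi | rfl
      · exact (ih i hi).trans hlt.le
      · exact le_rfl
    have h1 := unroll n (r n) hall
    have h2 := mul_le_mul_of_nonneg_right (sum_b n) (hr n)
    exact absurd (quad (r n) (by linarith [hrE n, sum_c n])) (not_le.2 hlt)

theorem exists_tendsto_of_succ_le_add {φ q : ℕ → ℝ} (hφ : ∀ n, 0 ≤ φ n) (hq : ∀ n, 0 ≤ q n)
    (hqs : Summable q) (h : ∀ n, φ (n + 1) ≤ φ n + q n) : ∃ l, Tendsto φ atTop (𝓝 l) := by
  have hanti : Antitone fun n => φ n - ∑ i ∈ Finset.range n, q i := by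
    refine antitone_nat_of_succ_le fun n => ?_
    rw [Finset.sum_range_succ]
    linarith [h n]
  have hbdd : BddBelow (Set.range fun n => φ n - ∑ i ∈ Finset.range n, q i) := by
    refine ⟨-∑' i, q i, ?_⟩
    rintro _ ⟨n, rfl⟩
    have := hqs.sum_le_tsum (Finset.range n) fun i _ => hq i
    simp only
    linarith [hφ n]
  have h1 := (tendsto_atTop_ciInf hanti hbdd).add hqs.hasSum.tendsto_sum_nat
  exact ⟨_, by simpa using h1⟩

end RealSequences

/-! ### Lyapunov analysis of the inexact inertial scheme. -/

section InertialScheme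

variable {E : Type*} [NormedAddCommGroup E] [InnerProductSpace ℝ E]

/-- An inexact inertial proximal-type scheme: `X` is a sequence satisfying the inequality of
one proximal step from the point extrapolated with the inertia `(T n - 1) / T (n + 1)`. -/
structure InexactInertialScheme (S : Set E) (f : E → ℝ) (T : ℕ → ℝ) (c : ℝ) (X : ℕ → E)
    (δ η : ℕ → ℝ) : Prop where
  convexOn : ConvexOn ℝ S f
  mem : ∀ n, X n ∈ S
  c_pos : 0 < c
  one_le : ∀ n, 1 ≤ T n
  monotone : Monotone T
  growth : ∀ n, T (n + 1) ^ 2 - T n ^ 2 ≤ (1 - c) * T (n + 1)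
  δ_nonneg : ∀ n, 0 ≤ δ n
  η_nonneg : ∀ n, 0 ≤ η n
  summable_δ : Summable fun n => T (n + 1) * δ n
  summable_η : Summable fun n => T (n + 1) ^ 2 * η n
  step : ∀ n, ∀ v ∈ S, f (X (n + 2)) + ‖v - X (n + 2)‖ ^ 2 ≤
    f v + ‖v - (X (n + 1) + ((T n - 1) / T (n + 1)) • (X (n + 1) - X n))‖ ^ 2 +
      δ n * ‖v - X (n + 2)‖ + η n

namespace InexactInertialScheme

variable {S : Set E} {f : E → ℝ} {T : ℕ → ℝ} {c : ℝ} {X : ℕ → E} {δ η : ℕ → ℝ} {s : E}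

/-- The step inequality is tested at `v = (1 - 1/t) X (n + 1) + (1/t) s` and multiplied by `t ^ 2`,
where `t = T (n + 1)`. Scaled by `t`, both distances from `v` become distances from `s` to
consecutive points `X n + T n • (X (n + 1) - X n)`. Convexity leaves the weight `t ^ 2 - t` on the
old gap, and `growth` turns it into at most `T n ^ 2 - c * t`. -/
theorem energy_succ_le (H : InexactInertialScheme S f T c X δ η) (hs : s ∈ S)
    (hmin : ∀ v ∈ S, f s ≤ f v) (n : ℕ) :
    T (n + 1) ^ 2 * (f (X (n + 2)) - f s) +
        ‖X (n + 1) + T (n + 1) • (X (n + 2) - X (n + 1)) - s‖ ^ 2 +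
        c * T (n + 1) * (f (X (n + 1)) - f s) ≤
      T n ^ 2 * (f (X (n + 1)) - f s) + ‖X n + T n • (X (n + 1) - X n) - s‖ ^ 2 +
        T (n + 1) * δ n * ‖X (n + 1) + T (n + 1) • (X (n + 2) - X (n + 1)) - s‖ +
        T (n + 1) ^ 2 * η n := by
  set t := T (n + 1) with ht
  have ht1 : 1 ≤ t := H.one_le _
  have ht0 : 0 < t := by linarith
  have hle : 1 / t ≤ 1 := by rwa [div_le_one ht0]
  have hW : 0 ≤ f (X (n + 1)) - f s := sub_nonneg.2 (hmin _ (H.mem _))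
  have hmem := H.convexOn.1 (H.mem (n + 1)) hs (sub_nonneg.2 hle) (by positivity)
    (sub_add_cancel 1 (1 / t))
  have hcv := H.convexOn.2 (H.mem (n + 1)) hs (sub_nonneg.2 hle) (by positivity)
    (sub_add_cancel 1 (1 / t))
  have hst := H.step n _ hmem
  set v := (1 - 1 / t) • X (n + 1) + (1 / t) • s with hv
  have e1 : t • (v - X (n + 2)) = s - (X (n + 1) + t • (X (n + 2) - X (n + 1))) := by
    rw [hv]; match_scalars <;> field_simp <;> ring
  have e2 : t • (v - (X (n + 1) + ((T n - 1) / t) • (X (n + 1) - X n))) =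
      s - (X n + T n • (X (n + 1) - X n)) := by
    rw [hv]; match_scalars <;> field_simp <;> ring
  have n1 := congrArg norm e1
  have n2 := congrArg norm e2
  rw [norm_smul, Real.norm_of_nonneg ht0.le, norm_sub_rev s] at n1 n2
  rw [← n1, ← n2]
  simp only [smul_eq_mul] at hcv
  have hcv' : t ^ 2 * f v ≤ (t ^ 2 - t) * f (X (n + 1)) + t * f s := by
    have h1 := mul_le_mul_of_nonneg_left hcv (sq_nonneg t)
    have h2 : t ^ 2 * ((1 - 1 / t) * f (X (n + 1)) + 1 / t * f s) =
        (t ^ 2 - t) * f (X (n + 1)) + t * f s := by field_simp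
    rwa [h2] at h1
  have hst' := mul_le_mul_of_nonneg_left hst (sq_nonneg t)
  have hg := mul_le_mul_of_nonneg_right (H.growth n) hW
  rw [← ht] at hg
  nlinarith

theorem bounded_and_summable_gap (H : InexactInertialScheme S f T c X δ η) (hs : s ∈ S)
    (hmin : ∀ v ∈ S, f s ≤ f v) :
    ∃ M, 0 ≤ M ∧ (∀ n, T n ^ 2 * (f (X (n + 1)) - f s) ≤ M) ∧
      (∀ n, ‖X n + T n • (X (n + 1) - X n) - s‖ ≤ M) ∧
      Summable fun n => T (n + 1) * (f (X (n + 1)) - f s) := by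
  have hT : ∀ n, 0 ≤ T n := fun n => zero_le_one.trans (H.one_le n)
  have hW : ∀ n, 0 ≤ f (X n) - f s := fun n => sub_nonneg.2 (hmin _ (H.mem n))
  set r : ℕ → ℝ := fun n => ‖X n + T n • (X (n + 1) - X n) - s‖ with hr
  set En : ℕ → ℝ := fun n => T n ^ 2 * (f (X (n + 1)) - f s) + r n ^ 2 with hEn
  have hr0 : ∀ n, 0 ≤ r n := fun n => norm_nonneg _
  have hrE : ∀ n, r n ^ 2 ≤ En n := fun n =>
    le_add_of_nonneg_left (mul_nonneg (sq_nonneg _) (hW _))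
  have hp : ∀ n, 0 ≤ c * T (n + 1) * (f (X (n + 1)) - f s) := fun n =>
    mul_nonneg (mul_nonneg H.c_pos.le (hT _)) (hW _)
  have hb : ∀ n, 0 ≤ T (n + 1) * δ n := fun n => mul_nonneg (hT _) (H.δ_nonneg n)
  have hc : ∀ n, 0 ≤ T (n + 1) ^ 2 * η n := fun n => mul_nonneg (sq_nonneg _) (H.η_nonneg n)
  have hen : ∀ n, En (n + 1) + c * T (n + 1) * (f (X (n + 1)) - f s) ≤
      En n + T (n + 1) * δ n * r (n + 1) + T (n + 1) ^ 2 * η n := H.energy_succ_le hs hmin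
  -- The error contains the new distance `r (n + 1)`, so it is summable only once `r` is known to be
  -- bounded.
  obtain ⟨M, hM0, hM⟩ := bounded_of_le_add_mul_sqrt hr0 hrE hb hc H.summable_δ H.summable_η
    (fun n => by linarith [hen n, hp n])
  have hc' : ∀ n, 0 ≤ T (n + 1) * δ n * M + T (n + 1) ^ 2 * η n := fun n =>
    add_nonneg (mul_nonneg (hb n) hM0) (hc n)
  obtain ⟨hsum, hbd⟩ := summable_and_bounded_of_le_add
    (fun n => (sq_nonneg _).trans (hrE n)) hp hc'
    ((H.summable_δ.mul_right M).add H.summable_η)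
    (fun n => by linarith [hen n, mul_le_mul_of_nonneg_left (hM (n + 1)) (hb n)])
  set M' := En 0 + ∑' i, (T (i + 1) * δ i * M + T (i + 1) ^ 2 * η i)
  refine ⟨max M M', le_max_of_le_left hM0, fun n => le_max_of_le_right ?_,
    fun n => le_max_of_le_left (hM n), ?_⟩
  · exact (le_add_of_nonneg_right (sq_nonneg (r n))).trans (hbd n)
  · simp_rw [mul_assoc] at hsum
    exact (summable_mul_left_iff H.c_pos.ne').1 hsum

/-- `X (n + 1) - s` is a convex combination, with weights `1 - 1 / T n` and `1 / T n`, of `X n - s`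
and the bounded vector of the energy. -/
theorem exists_norm_sub_le (H : InexactInertialScheme S f T c X δ η) (hs : s ∈ S)
    (hmin : ∀ v ∈ S, f s ≤ f v) : ∃ M, 0 ≤ M ∧ ∀ n, ‖X n - s‖ ≤ M := by
  obtain ⟨M, hM0, -, hu, -⟩ := H.bounded_and_summable_gap hs hmin
  refine ⟨max M ‖X 0 - s‖, le_max_of_le_left hM0, fun n => ?_⟩
  induction n with
  | zero => exact le_max_right _ _
  | succ n ih =>
    have ht1 := H.one_le n
    have ht0 : 0 < T n := by linarith
    have e : T n • (X (n + 1) - s) =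
        (T n - 1) • (X n - s) + (X n + T n • (X (n + 1) - X n) - s) := by module
    have h1 := congrArg norm e
    rw [norm_smul, Real.norm_of_nonneg ht0.le] at h1
    have h2 := norm_add_le ((T n - 1) • (X n - s)) (X n + T n • (X (n + 1) - X n) - s)
    rw [norm_smul, Real.norm_of_nonneg (sub_nonneg.2 ht1)] at h2
    have h3 := mul_le_mul_of_nonneg_left ih (sub_nonneg.2 ht1)
    have h4 := (hu n).trans (le_max_left M ‖X 0 - s‖)
    refine le_of_mul_le_mul_left ?_ ht0
    linarith

/-- With `v = X (n + 1)` the squared velocity has weight `T (n + 1) ^ 2` on the new side and `(T n -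
1) ^ 2` on the old one. Relative to `T n ^ 2` this loses `2 * T n - 1 ≥ T n`, while the growing
weight of the gap costs only the summable `T * gap`. -/
theorem summable_velocity (H : InexactInertialScheme S f T c X δ η) (hs : s ∈ S)
    (hmin : ∀ v ∈ S, f s ≤ f v) : Summable fun n => T n * ‖X (n + 1) - X n‖ ^ 2 := by
  have hT : ∀ n, 0 ≤ T n := fun n => zero_le_one.trans (H.one_le n)
  have hW : ∀ n, 0 ≤ f (X n) - f s := fun n => sub_nonneg.2 (hmin _ (H.mem n))
  obtain ⟨M, hM0, -, hu, hgap⟩ := H.bounded_and_summable_gap hs hmin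
  obtain ⟨M', hM'0, hX⟩ := H.exists_norm_sub_le hs hmin
  have hvel : ∀ n, T n * ‖X (n + 1) - X n‖ ≤ M + M' := by
    intro n
    have e : T n • (X (n + 1) - X n) = (X n + T n • (X (n + 1) - X n) - s) - (X n - s) := by
      module
    have h1 := congrArg norm e
    rw [norm_smul, Real.norm_of_nonneg (hT n)] at h1
    rw [h1]
    exact (norm_sub_le _ _).trans (add_le_add (hu n) (hX n))
  have hb : ∀ n, 0 ≤ T (n + 1) * δ n := fun n => mul_nonneg (hT _) (H.δ_nonneg n)
  have hc : ∀ n, 0 ≤ T (n + 1) * (f (X (n + 1)) - f s) +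
      (T (n + 1) * δ n * (M + M') + T (n + 1) ^ 2 * η n) := fun n =>
    add_nonneg (mul_nonneg (hT _) (hW _)) (add_nonneg (mul_nonneg (hb n) (by linarith))
      (mul_nonneg (sq_nonneg _) (H.η_nonneg n)))
  refine (summable_and_bounded_of_le_add
    (E := fun n => T n ^ 2 * (‖X (n + 1) - X n‖ ^ 2 + (f (X (n + 1)) - f s)))
    (fun n => mul_nonneg (sq_nonneg _) (add_nonneg (sq_nonneg _) (hW _)))
    (fun n => mul_nonneg (hT n) (sq_nonneg _)) hc
    (hgap.add ((H.summable_δ.mul_right (M + M')).add H.summable_η)) fun n => ?_).1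
  have hst := H.step n _ (H.mem (n + 1))
  have ht0 : 0 < T (n + 1) := zero_lt_one.trans_le (H.one_le _)
  have e1 : X (n + 1) - (X (n + 1) + ((T n - 1) / T (n + 1)) • (X (n + 1) - X n)) =
      -(((T n - 1) / T (n + 1)) • (X (n + 1) - X n)) := by abel
  rw [e1, norm_neg, norm_smul,
    Real.norm_of_nonneg (div_nonneg (sub_nonneg.2 (H.one_le n)) ht0.le),
    norm_sub_rev (X (n + 1)) (X (n + 2))] at hst
  have hst' := mul_le_mul_of_nonneg_left hst (sq_nonneg (T (n + 1)))
  have e2 : T (n + 1) ^ 2 * (f (X (n + 1)) + ((T n - 1) / T (n + 1) * ‖X (n + 1) - X n‖) ^ 2 +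
      δ n * ‖X (n + 2) - X (n + 1)‖ + η n) =
      T (n + 1) ^ 2 * f (X (n + 1)) + (T n - 1) ^ 2 * ‖X (n + 1) - X n‖ ^ 2 +
        T (n + 1) * δ n * (T (n + 1) * ‖X (n + 2) - X (n + 1)‖) + T (n + 1) ^ 2 * η n := by
    field_simp
  rw [e2] at hst'
  have h1 := mul_le_mul_of_nonneg_left (hvel (n + 1)) (hb n)
  have h2 : T (n + 1) ^ 2 - T n ^ 2 ≤ T (n + 1) := by
    nlinarith [H.growth n, mul_pos H.c_pos ht0]
  have h3 := mul_le_mul_of_nonneg_right h2 (hW (n + 1))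
  have h4 : T n * ‖X (n + 1) - X n‖ ^ 2 ≤ (T n ^ 2 - (T n - 1) ^ 2) * ‖X (n + 1) - X n‖ ^ 2 :=
    mul_le_mul_of_nonneg_right (by nlinarith [H.one_le n]) (sq_nonneg _)
  have e3 : X (n + 1 + 1) = X (n + 2) := rfl
  simp only [e3] at h1 ⊢
  linarith

theorem exists_tendsto_norm_sub (H : InexactInertialScheme S f T c X δ η) (hs : s ∈ S)
    (hmin : ∀ v ∈ S, f s ≤ f v) : ∃ l, Tendsto (fun n => ‖X n - s‖ ^ 2) atTop (𝓝 l) := by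
  have hT : ∀ n, 0 ≤ T n := fun n => zero_le_one.trans (H.one_le n)
  have hvel := H.summable_velocity hs hmin
  obtain ⟨M, hM0, hX⟩ := H.exists_norm_sub_le hs hmin
  set φ : ℕ → ℝ := fun n => ‖X n - s‖ ^ 2 with hφ
  -- The positive increments satisfy `T (n + 1) * q (n + 1) + q n ≤ T n * q n + e n`, so they are
  -- summable by telescoping, and `φ` converges.
  set q : ℕ → ℝ := fun n => max (φ (n + 1) - φ n) 0 with hq
  have hq0 : ∀ n, 0 ≤ q n := fun n => le_max_right _ _
  have hb : ∀ n, 0 ≤ T (n + 1) * δ n := fun n => mul_nonneg (hT _) (H.δ_nonneg n)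
  set e : ℕ → ℝ := fun n => 2 * (T n * ‖X (n + 1) - X n‖ ^ 2) +
    (T (n + 1) * δ n * M + T (n + 1) ^ 2 * η n) with he
  have he0 : ∀ n, 0 ≤ e n := fun n =>
    add_nonneg (mul_nonneg zero_le_two (mul_nonneg (hT n) (sq_nonneg _)))
      (add_nonneg (mul_nonneg (hb n) hM0) (mul_nonneg (sq_nonneg _) (H.η_nonneg n)))
  have hes : Summable e := (hvel.mul_left 2).add ((H.summable_δ.mul_right M).add H.summable_η)
  have hstep : ∀ n, T (n + 1) * (φ (n + 2) - φ (n + 1)) ≤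
      (T n - 1) * (φ (n + 1) - φ n) + e n := by
    intro n
    have hst := H.step n s hs
    have hm := hmin _ (H.mem (n + 2))
    have ht1 := H.one_le (n + 1)
    have ht0 : 0 < T (n + 1) := zero_lt_one.trans_le ht1
    set α := (T n - 1) / T (n + 1) with hα
    have hαT : T (n + 1) * α = T n - 1 := by rw [hα]; field_simp
    have hα0 : 0 ≤ α := div_nonneg (sub_nonneg.2 (H.one_le n)) ht0.le
    have n1 : ‖s - (X (n + 1) + α • (X (n + 1) - X n))‖ ^ 2 =
        (1 + α) * φ (n + 1) - α * φ n + (α + α ^ 2) * ‖X (n + 1) - X n‖ ^ 2 := by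
      have e1 : s - (X (n + 1) + α • (X (n + 1) - X n)) =
          -((X (n + 1) - s) + α • (X (n + 1) - X n)) := by abel
      have e2 : X n - s = (X (n + 1) - s) - (X (n + 1) - X n) := by abel
      have e3 := norm_sub_sq_real (X (n + 1) - s) (X (n + 1) - X n)
      rw [← e2] at e3
      rw [e1, norm_neg, norm_add_sq_real, norm_smul, Real.norm_of_nonneg hα0,
        real_inner_smul_right]
      simp only [hφ, e3]
      ring
    rw [n1, norm_sub_rev s] at hst
    have h1 : φ (n + 2) ≤ (1 + α) * φ (n + 1) - α * φ n +
        (α + α ^ 2) * ‖X (n + 1) - X n‖ ^ 2 + δ n * M + η n := by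
      have := mul_le_mul_of_nonneg_left (hX (n + 2)) (H.δ_nonneg n)
      simp only [hφ] at hst ⊢
      linarith
    have h2 := mul_le_mul_of_nonneg_left h1 ht0.le
    have hα2 : T (n + 1) * (α + α ^ 2) ≤ 2 * T n := by
      have hα1 : α ≤ 1 := by
        rw [hα, div_le_one ht0]
        linarith [H.monotone n.le_succ]
      nlinarith [H.one_le n]
    have h3 := mul_le_mul_of_nonneg_right hα2 (sq_nonneg ‖X (n + 1) - X n‖)
    have h4 : T (n + 1) * η n ≤ T (n + 1) ^ 2 * η n :=
      mul_le_mul_of_nonneg_right (by nlinarith) (H.η_nonneg n)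
    simp only [he]
    linear_combination h2 + h3 + h4 + (φ (n + 1) - φ n) * hαT
  have hqstep : ∀ n, T (n + 1) * q (n + 1) + q n ≤ T n * q n + e n := by
    intro n
    have h1 : (T n - 1) * (φ (n + 1) - φ n) ≤ (T n - 1) * q n :=
      mul_le_mul_of_nonneg_left (le_max_left _ _) (sub_nonneg.2 (H.one_le n))
    have h2 : 0 ≤ (T n - 1) * q n := mul_nonneg (sub_nonneg.2 (H.one_le n)) (hq0 n)
    have h3 : T (n + 1) * q (n + 1) ≤ (T n - 1) * q n + e n := by
      rcases max_cases (φ (n + 1 + 1) - φ (n + 1)) 0 with h | h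
      · simp only [hq] at h1 ⊢
        rw [h.1]
        exact (hstep n).trans (by linarith)
      · have : q (n + 1) = 0 := h.1
        rw [this, mul_zero]
        linarith [he0 n]
    linarith
  have hqs := (summable_and_bounded_of_le_add (fun n => mul_nonneg (hT n) (hq0 n)) hq0 he0 hes
    hqstep).1
  exact exists_tendsto_of_succ_le_add (fun n => sq_nonneg _) hq0 hqs
    fun n => by linarith [le_max_left (φ (n + 1) - φ n) 0]

end InexactInertialScheme

end InertialScheme

/-! ### Growth of the inertia parameters. -/

section Inertia

theorem Real.rpow_two_mul_eq_sq {x : ℝ} (hx : 0 ≤ x) (d : ℝ) : x ^ (2 * d) = (x ^ d) ^ 2 := by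
  rw [mul_comm, Real.rpow_mul hx, Real.rpow_two]

/-- Bernoulli's inequality bounds the increment by the tangent slope of the power `2d`: at `s + 1`
in the convex case `2d ≥ 1`, where `2d - 1 ≤ d`, and at `s` in the concave case, where the slope is
at most `2d`. -/
theorem rpow_add_one_sub_rpow_le {s d : ℝ} (hs : 1 ≤ s) (hd : 0 ≤ d) (hd1 : d ≤ 1) :
    (s + 1) ^ (2 * d) - s ^ (2 * d) ≤ 2 * d * (s + 1) ^ d := by
  have hs0 : 0 < s := by linarith
  rcases le_total 1 (2 * d) with h | h
  · have h1 : 1 + 2 * d * (-(1 / (s + 1))) ≤ (1 + -(1 / (s + 1))) ^ (2 * d) := by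
      refine one_add_mul_self_le_rpow_one_add ?_ h
      rw [neg_le_neg_iff, div_le_one (by linarith)]
      linarith
    have e1 : s = (s + 1) * (1 + -(1 / (s + 1))) := by field_simp; ring
    have e2 : s ^ (2 * d) = (s + 1) ^ (2 * d) * (1 + -(1 / (s + 1))) ^ (2 * d) := by
      rw [← Real.mul_rpow (by linarith), ← e1]
      by_contra hneg
      have : 1 / (s + 1) ≤ 1 := by rw [div_le_one (by linarith)]; linarith
      linarith
    have h2 := mul_le_mul_of_nonneg_left h1 (Real.rpow_nonneg (by linarith : 0 ≤ s + 1) (2 * d))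
    rw [← e2] at h2
    have e3 : (s + 1) ^ (2 * d) * (1 / (s + 1)) = (s + 1) ^ (2 * d - 1) := by
      rw [Real.rpow_sub_one (by linarith)]; ring
    have h3 : (s + 1) ^ (2 * d - 1) ≤ (s + 1) ^ d :=
      Real.rpow_le_rpow_of_exponent_le (by linarith) (by linarith)
    have h4 := mul_le_mul_of_nonneg_left h3 (by linarith : 0 ≤ 2 * d)
    rw [← e3] at h4
    linarith
  · have h1 : (1 + 1 / s) ^ (2 * d) ≤ 1 + 2 * d * (1 / s) :=
      rpow_one_add_le_one_add_mul_self (by have : 0 < 1 / s := by positivity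
                                           linarith) (by linarith) h
    have e1 : s + 1 = s * (1 + 1 / s) := by field_simp
    have e2 : (s + 1) ^ (2 * d) = s ^ (2 * d) * (1 + 1 / s) ^ (2 * d) := by
      rw [← Real.mul_rpow hs0.le (by positivity), ← e1]
    have h2 := mul_le_mul_of_nonneg_left h1 (Real.rpow_nonneg hs0.le (2 * d))
    rw [← e2] at h2
    have e3 : s ^ (2 * d) * (1 / s) = s ^ (2 * d - 1) := by
      rw [Real.rpow_sub_one hs0.ne']; ring
    have h3 : s ^ (2 * d - 1) ≤ 1 := Real.rpow_le_one_of_one_le_of_nonpos hs (by linarith)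
    have h4 : 1 ≤ (s + 1) ^ d := Real.one_le_rpow (by linarith) hd
    have h5 := mul_le_mul_of_nonneg_left (h3.trans h4) (by linarith : 0 ≤ 2 * d)
    rw [← e3] at h5
    linarith

variable {a d : ℝ}

theorem AdmissibleInertia.pos (h : AdmissibleInertia a d) : 0 < a := by
  rcases h with h | h
  · exact h.2
  · exact zero_lt_one.trans ((le_max_left _ _).trans_lt h.2.2)

theorem AdmissibleInertia.nonneg (h : AdmissibleInertia a d) : 0 ≤ d := by
  rcases h with h | h
  · exact h.1.ge
  · exact h.1.le

/-- This is where `a > (2d)^{1/d}` enters: it makes the growth constant `c` positive. -/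
theorem AdmissibleInertia.two_mul_div_lt_one (h : AdmissibleInertia a d) : 2 * d / a ^ d < 1 := by
  have ha := h.pos
  rw [div_lt_one (Real.rpow_pos_of_pos ha d)]
  rcases h with ⟨rfl, -⟩ | ⟨hd, -, h⟩
  · simp
  · have h1 := Real.rpow_lt_rpow (by positivity) ((le_max_right _ _).trans_lt h) hd
    rwa [← Real.rpow_mul (by positivity), one_div_mul_cancel hd.ne', Real.rpow_one] at h1

theorem one_le_inertiaT (h : AdmissibleInertia a d) : ∀ k, 1 ≤ inertiaT a d k
  | 0 => le_rfl
  | k + 1 => Real.one_le_rpow (by rw [le_div_iff₀ h.pos]; linarith [k.cast_nonneg (α := ℝ)])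
      h.nonneg

theorem inertiaT_monotone (h : AdmissibleInertia a d) : Monotone (inertiaT a d) := by
  refine monotone_nat_of_le_succ fun k => ?_
  have ha := h.pos
  cases k with
  | zero => exact one_le_inertiaT h 1
  | succ k =>
    refine Real.rpow_le_rpow (by positivity) ?_ h.nonneg
    gcongr
    simp

theorem inertiaT_growth (h : AdmissibleInertia a d) (k : ℕ) :
    inertiaT a d (k + 2) ^ 2 - inertiaT a d (k + 1) ^ 2 ≤
      (1 - (1 - 2 * d / a ^ d)) * inertiaT a d (k + 2) := by
  have ha := h.pos
  have had : 0 < a ^ d := Real.rpow_pos_of_pos ha d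
  have key : ((k + a + 1) ^ d) ^ 2 - ((k + a) ^ d) ^ 2 ≤ 2 * d * (k + a + 1) ^ d := by
    rcases h with ⟨rfl, -⟩ | ⟨hd, hd1, h⟩
    · simp
    · have h1 : 1 ≤ (k : ℝ) + a := by
        linarith [(le_max_left _ _).trans_lt h, k.cast_nonneg (α := ℝ)]
      rw [← Real.rpow_two_mul_eq_sq (by linarith), ← Real.rpow_two_mul_eq_sq (by linarith)]
      exact rpow_add_one_sub_rpow_le h1 hd.le hd1
  have e : ((k + 1 : ℕ) : ℝ) + a = k + a + 1 := by push_cast; ring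
  simp only [inertiaT]
  rw [e, Real.div_rpow (by positivity) ha.le, Real.div_rpow (by positivity) ha.le]
  have h1 : ((k + a + 1) ^ d / a ^ d) ^ 2 - ((k + a) ^ d / a ^ d) ^ 2 =
      (((k + a + 1) ^ d) ^ 2 - ((k + a) ^ d) ^ 2) / (a ^ d) ^ 2 := by ring
  have h2 : (1 - (1 - 2 * d / a ^ d)) * ((k + a + 1) ^ d / a ^ d) =
      2 * d * (k + a + 1) ^ d / (a ^ d) ^ 2 := by ring
  rw [h1, h2]
  gcongr

theorem inertiaT_le (h : AdmissibleInertia a d) {k : ℕ} (hk : 1 ≤ k) :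
    inertiaT a d k ≤ ((1 + a) / a) ^ d * (k : ℝ) ^ d := by
  have ha := h.pos
  obtain ⟨k, rfl⟩ := Nat.exists_eq_add_of_le' hk
  rw [← Real.mul_rpow (by positivity) (by positivity)]
  refine Real.rpow_le_rpow (by positivity) ?_ h.nonneg
  rw [div_mul_eq_mul_div]
  gcongr
  push_cast
  nlinarith [mul_nonneg ha.le (k.cast_nonneg (α := ℝ))]

theorem rpow_succ_le_inertiaT (h : AdmissibleInertia a d) {k : ℕ} (hk : 1 ≤ k) :
    ((k + 1 : ℕ) : ℝ) ^ d ≤ (a + 2) ^ d * inertiaT a d k := by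
  have ha := h.pos
  obtain ⟨k, rfl⟩ := Nat.exists_eq_add_of_le' hk
  simp only [inertiaT]
  rw [← Real.mul_rpow (by positivity) (by positivity)]
  refine Real.rpow_le_rpow (by positivity) ?_ h.nonneg
  rw [mul_div_assoc', le_div_iff₀ ha]
  push_cast
  nlinarith [k.cast_nonneg (α := ℝ), mul_nonneg ha.le (k.cast_nonneg (α := ℝ))]

end Inertia

/-! ### Finiteness of the coarse corrections. -/

theorem eventually_not_coarseStep (descent : ℕ → Prop) (p : ℕ) :
    ∃ K, ∀ k, K ≤ k → ¬ CoarseStep descent p k := by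
  have hstep : ∀ k, CoarseStep descent p k →
      correctionCount descent p (k + 1) = correctionCount descent p k + 1 := fun k hk => by
    rw [correctionCount]; exact if_pos hk
  have hle : ∀ k, correctionCount descent p k ≤ p := by
    intro k
    induction k with
    | zero => exact Nat.zero_le _
    | succ k ih => rw [correctionCount]; split_ifs with h <;> omega
  have hmono : Monotone (correctionCount descent p) := by
    refine monotone_nat_of_le_succ fun k => ?_
    rw [correctionCount]; split_ifs <;> omega
  obtain ⟨K, hK⟩ : ∃ K, ∀ k, correctionCount descent p k ≤ correctionCount descent p K := by
    have hfin : (Set.range (correctionCount descent p)).Finite :=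
      (Set.finite_Iic p).subset (by rintro _ ⟨k, rfl⟩; exact hle k)
    obtain ⟨_, ⟨K, rfl⟩, hK⟩ := hfin.exists_maximal (Set.range_nonempty _)
    refine ⟨K, fun k => ?_⟩
    by_contra! hlt
    exact absurd (hK ⟨k, rfl⟩ hlt.le) (not_le.2 hlt)
  refine ⟨K, fun k hk hc => ?_⟩
  have := hK (k + 1)
  have := hmono hk
  have := hstep k hc
  omega

/-! ### Minimizers of the objective and Opial's argument. -/

section Objective

variable {n : ℕ} {L : Euc n → ℝ} {R : Euc n → EReal}

theorem objective_ne_top_iff {x : Euc n} : objective L R x ≠ ⊤ ↔ R x ≠ ⊤ := by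
  refine not_congr ⟨fun h => ?_, fun h => by rw [objective, h, EReal.coe_add_top]⟩
  by_contra hx
  exact EReal.add_ne_top (EReal.coe_ne_top _) hx h

theorem objective_eq_coe (hR : ProperConvexLsc R) {x : Euc n} (hx : R x ≠ ⊤) :
    objective L R x = ((L x + (R x).toReal : ℝ) : EReal) := by
  rw [EReal.coe_add, hR.coe_toReal hx, objective]

theorem lowerSemicontinuous_objective (hL : Continuous L) (hR : ProperConvexLsc R) :
    LowerSemicontinuous (objective L R) :=
  (continuous_coe_real_ereal.comp hL).lowerSemicontinuous.add' hR.lsc fun _ =>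
    EReal.continuousAt_add (Or.inl (EReal.coe_ne_top _)) (Or.inl (EReal.coe_ne_bot _))

theorem minimizers_nonempty (hL : Continuous L) (hR : ProperConvexLsc R)
    (hF : Coercive (objective L R)) : (minimizers (objective L R)).Nonempty := by
  obtain ⟨u, hu⟩ := hR.exists_ne_top
  have hu' : objective L R u < ⊤ := lt_top_iff_ne_top.2 (objective_ne_top_iff.2 hu)
  have hev := hF.eventually (lt_mem_nhds hu')
  obtain ⟨r, -, hr⟩ := (Metric.hasBasis_cobounded_compl_closedBall (0 : Euc n)).eventually_iff.1 hev
  have hub : u ∈ Metric.closedBall (0 : Euc n) r := by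
    by_contra h
    exact lt_irrefl _ (hr h)
  obtain ⟨s, -, hs⟩ := ((lowerSemicontinuous_objective hL hR).lowerSemicontinuousOn _).exists_isMinOn
    ⟨u, hub⟩ (isCompact_closedBall 0 r)
  refine ⟨s, fun v => ?_⟩
  by_cases hv : v ∈ Metric.closedBall (0 : Euc n) r
  · exact hs hv
  · exact (hs hub).trans (hr hv).le

theorem ne_top_of_mem_minimizers (hR : ProperConvexLsc R) {s : Euc n}
    (hs : s ∈ minimizers (objective L R)) : R s ≠ ⊤ := by
  obtain ⟨u, hu⟩ := hR.exists_ne_top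
  exact objective_ne_top_iff.1
    ((hs u).trans_lt (lt_top_iff_ne_top.2 (objective_ne_top_iff.2 hu))).ne

theorem le_of_mem_minimizers (hR : ProperConvexLsc R) {s v : Euc n}
    (hs : s ∈ minimizers (objective L R)) (hv : R v ≠ ⊤) :
    L s + (R s).toReal ≤ L v + (R v).toReal := by
  have := hs v
  rwa [objective_eq_coe hR (ne_top_of_mem_minimizers hR hs), objective_eq_coe hR hv,
    EReal.coe_le_coe_iff] at this

theorem convexOn_objective (hL : ConvexOn ℝ Set.univ L) (hR : ProperConvexLsc R) {τ : ℝ}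
    (hτ : 0 < τ) : ConvexOn ℝ {x | R x ≠ ⊤} fun x => 2 * τ * (L x + (R x).toReal) :=
  ((hL.subset (Set.subset_univ _) hR.convexOn_toReal.1).add hR.convexOn_toReal).smul
    (by positivity : 0 ≤ 2 * τ)

/-- A bounded sequence of points whose values tend to the minimum and whose distance to each
minimizer converges is itself convergent to a minimizer. -/
theorem exists_tendsto_minimizer {F : Euc n → EReal} (hF : LowerSemicontinuous F) {X : ℕ → Euc n}
    {s : Euc n} (hs : s ∈ minimizers F) (hlim : Tendsto (fun k => F (X k)) atTop (𝓝 (F s)))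
    (hdist : ∀ u ∈ minimizers F, ∃ l, Tendsto (fun k => ‖X k - u‖ ^ 2) atTop (𝓝 l)) :
    ∃ u ∈ minimizers F, Tendsto X atTop (𝓝 u) := by
  obtain ⟨l, hl⟩ := hdist s hs
  obtain ⟨M, hM⟩ := hl.bddAbove_range
  have hbdd : ∀ k, X k ∈ Metric.closedBall s √M := fun k => by
    rw [Metric.mem_closedBall, dist_eq_norm]
    exact Real.le_sqrt_of_sq_le (hM ⟨k, rfl⟩)
  obtain ⟨u, -, φ, hφ, hu⟩ := (isCompact_closedBall s √M).tendsto_subseq hbdd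
  have hmin : u ∈ minimizers F := by
    intro v
    refine le_trans ?_ (hs v)
    by_contra! hlt
    obtain ⟨q, hq1, hq2⟩ := exists_between hlt
    have h1 := hu.eventually (hF u q hq2)
    have h2 := ge_of_tendsto (hlim.comp hφ.tendsto_atTop) (h1.mono fun k hk => le_of_lt hk)
    exact absurd hq1 (not_lt.2 h2)
  refine ⟨u, hmin, ?_⟩
  obtain ⟨l', hl'⟩ := hdist u hmin
  have h0 : Tendsto (fun k => ‖X (φ k) - u‖ ^ 2) atTop (𝓝 0) := by
    have := (tendsto_iff_norm_sub_tendsto_zero.1 hu).pow 2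
    simpa using this
  rw [tendsto_nhds_unique (hl'.comp hφ.tendsto_atTop) h0] at hl'
  rw [tendsto_iff_norm_sub_tendsto_zero]
  have := hl'.sqrt
  simpa [Real.sqrt_sq (norm_nonneg _)] using this

end Objective

/-! ### From a run of the algorithm to the abstract scheme. -/

section Run

variable {n nH : ℕ} {L : Euc n → ℝ} {R : Euc n → EReal} {β : ℝ≥0} {τ : ℝ}
  {approx : ℝ → Euc n → Euc n → Prop} {Res : Euc n →ₗ[ℝ] Euc nH} {Pro : Euc nH →ₗ[ℝ] Euc n}
  {Φ : ℕ → ℕ → Euc nH → Euc nH} {m : ℕ} {τbar : ℕ → ℝ} {descent : ℕ → Prop} {p : ℕ}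
  {a d : ℝ} {ε δ η : ℕ → ℝ} {x y ybar : ℕ → Euc n}

theorem IsIMLFISTA.exists_inertialScheme
    (hrun : IsIMLFISTA L τ approx Res Pro Φ m τbar descent p a d ε x y ybar)
    (hL_conv : ConvexOn ℝ Set.univ L) (hL_diff : Differentiable ℝ L)
    (hL_lip : LipschitzWith β (∇ L)) (hR : ProperConvexLsc R)
    (hτ : 0 < τ) (hτβ : τ * β < 1) (had : AdmissibleInertia a d)
    (hdom : ∀ k, R (x (k + 1)) ≠ ⊤)
    (hsub : ∀ k v, R v ≠ ⊤ → (R (x (k + 1))).toReal + τ⁻¹ * inner ℝ (v - x (k + 1))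
        (ybar k - τ • ∇ L (ybar k) - x (k + 1)) ≤
      (R v).toReal + δ k * ‖v - x (k + 1)‖ + η k)
    (hδ : ∀ k, 0 ≤ δ k) (hη : ∀ k, 0 ≤ η k)
    (hδs : Summable fun k => inertiaT a d k * δ k)
    (hηs : Summable fun k => inertiaT a d k ^ 2 * η k) :
    ∃ K, 1 ≤ K ∧ InexactInertialScheme {x | R x ≠ ⊤} (fun x => 2 * τ * (L x + (R x).toReal))
      (fun k => inertiaT a d (K + k)) (1 - 2 * d / a ^ d) (fun k => x (K + k))
      (fun k => 2 * τ * δ (K + k + 1)) (fun k => 2 * τ * η (K + k + 1)) := by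
  obtain ⟨K, hK⟩ := eventually_not_coarseStep descent p
  have hinj : Function.Injective fun k => K + 1 + k + 1 := fun i j h => by
    simp only at h; omega
  -- Starting at `K + 1` rather than `K` makes the first point a proximal output, hence in the
  -- domain of `R`; the arbitrary `x 0` need not be.
  refine ⟨K + 1, by omega, convexOn_objective hL_conv hR hτ, fun k => ?_, ?_,
    fun k => one_le_inertiaT had _, fun i j hij => inertiaT_monotone had (by omega), fun k => ?_,
    fun k => mul_nonneg (by positivity) (hδ _), fun k => mul_nonneg (by positivity) (hη _),
    ?_, ?_, fun k v hv => ?_⟩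
  · have := hdom (K + k)
    rwa [show K + k + 1 = K + 1 + k by omega] at this
  · linarith [had.two_mul_div_lt_one]
  · have := inertiaT_growth had (K + k)
    rw [show K + k + 2 = K + 1 + (k + 1) by omega, show K + k + 1 = K + 1 + k by omega] at this
    exact this
  · refine ((hδs.comp_injective hinj).mul_left (2 * τ)).congr fun k => ?_
    simp only [Function.comp_apply, add_assoc]
    ring
  · refine ((hηs.comp_injective hinj).mul_left (2 * τ)).congr fun k => ?_
    simp only [Function.comp_apply, add_assoc]
    ring
  · have h1 := forward_backward_ineq hL_conv hL_diff hL_lip hτ hτβ (hsub (K + 1 + k + 1) v hv)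
    rw [hrun.standard_step _ (hK (K + 1 + k + 1) (by omega)), hrun.inertial] at h1
    exact h1

theorem IsIMLFISTA.convergence
    (hrun : IsIMLFISTA L τ approx Res Pro Φ m τbar descent p a d ε x y ybar)
    (hL_conv : ConvexOn ℝ Set.univ L) (hL_diff : Differentiable ℝ L)
    (hL_lip : LipschitzWith β (∇ L)) (hR : ProperConvexLsc R)
    (hF : Coercive (objective L R))
    (hτ : 0 < τ) (hτβ : τ * β < 1) (had : AdmissibleInertia a d)
    (hdom : ∀ k, R (x (k + 1)) ≠ ⊤)
    (hsub : ∀ k v, R v ≠ ⊤ → (R (x (k + 1))).toReal + τ⁻¹ * inner ℝ (v - x (k + 1))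
        (ybar k - τ • ∇ L (ybar k) - x (k + 1)) ≤
      (R v).toReal + δ k * ‖v - x (k + 1)‖ + η k)
    (hδ : ∀ k, 0 ≤ δ k) (hη : ∀ k, 0 ≤ η k)
    (hδs : Summable fun k => inertiaT a d k * δ k)
    (hηs : Summable fun k => inertiaT a d k ^ 2 * η k) :
    (∀ k, 1 ≤ k → objective L R (x k) ≠ ⊤) ∧
    (∀ xstar ∈ minimizers (objective L R), objective L R xstar ≠ ⊤ ∧
      Memℓp (E := fun _ : ℕ => ℝ) (fun k : ℕ => (k : ℝ) ^ (2 * d) *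
        ((objective L R (x k)).toReal - (objective L R xstar).toReal)) ∞) ∧
    ∃ xstar ∈ minimizers (objective L R), Tendsto x atTop (𝓝 xstar) := by
  obtain ⟨K, hK1, H⟩ := hrun.exists_inertialScheme hL_conv hL_diff hL_lip hR hτ hτβ had hdom hsub
    hδ hη hδs hηs
  have hmin : ∀ s ∈ minimizers (objective L R), ∀ v ∈ {x | R x ≠ ⊤},
      2 * τ * (L s + (R s).toReal) ≤ 2 * τ * (L v + (R v).toReal) := fun s hs v hv =>
    mul_le_mul_of_nonneg_left (le_of_mem_minimizers hR hs hv) (by positivity)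
  have hdomS : ∀ s ∈ minimizers (objective L R), R s ≠ ⊤ := fun s hs =>
    ne_top_of_mem_minimizers hR hs
  have hobj : ∀ v, R v ≠ ⊤ → (objective L R v).toReal = L v + (R v).toReal := fun v hv => by
    rw [objective_eq_coe hR hv, EReal.toReal_coe]
  refine ⟨fun k hk => ?_, fun s hs => ⟨objective_ne_top_iff.2 (hdomS s hs), ?_⟩, ?_⟩
  · obtain ⟨k, rfl⟩ := Nat.exists_eq_add_of_le' hk
    exact objective_ne_top_iff.2 (hdom k)
  · obtain ⟨M, hM0, hM, -, -⟩ := H.bounded_and_summable_gap (hdomS s hs) (hmin s hs)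
    -- An eventual bound suffices, so the initial terms, including a possibly infinite value at `x
    -- 0`, do not matter. The factor `2τ` undoes the scaling of `f`; `(a + 2) ^ d` compares `k ^ d`
    -- with the parameter of index `k - 1`, which weights the gap at `x k`.
    refine memℓp_infty (Filter.IsBoundedUnder.bddAbove_range ⟨((a + 2) ^ d) ^ 2 * (M / (2 * τ)), ?_⟩)
    rw [eventually_map]
    filter_upwards [eventually_ge_atTop (K + 1)] with k hk
    obtain ⟨j, rfl⟩ := Nat.exists_eq_add_of_le hk
    have e : K + 1 + j = K + j + 1 := by omega
    have hx : R (x (K + j + 1)) ≠ ⊤ := hdom _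
    rw [e, hobj _ hx, hobj _ (hdomS s hs)]
    have hW : 0 ≤ L (x (K + j + 1)) + (R (x (K + j + 1))).toReal - (L s + (R s).toReal) :=
      sub_nonneg.2 (le_of_mem_minimizers hR hs hx)
    rw [Real.norm_of_nonneg (mul_nonneg (by positivity) hW),
      Real.rpow_two_mul_eq_sq (by positivity)]
    have h1 : inertiaT a d (K + j) ^ 2 * (L (x (K + j + 1)) + (R (x (K + j + 1))).toReal -
        (L s + (R s).toReal)) ≤ M / (2 * τ) := by
      rw [le_div_iff₀ (by positivity)]
      have := hM j
      simp only [← add_assoc] at this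
      linarith
    have h2 := rpow_succ_le_inertiaT had (hK1.trans (Nat.le_add_right K j))
    calc _ ≤ ((a + 2) ^ d * inertiaT a d (K + j)) ^ 2 *
          (L (x (K + j + 1)) + (R (x (K + j + 1))).toReal - (L s + (R s).toReal)) :=
          mul_le_mul_of_nonneg_right (pow_le_pow_left₀ (by positivity) h2 2) hW
      _ = ((a + 2) ^ d) ^ 2 * (inertiaT a d (K + j) ^ 2 *
          (L (x (K + j + 1)) + (R (x (K + j + 1))).toReal - (L s + (R s).toReal))) := by ring
      _ ≤ _ := mul_le_mul_of_nonneg_left h1 (sq_nonneg _)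
  · obtain ⟨s, hs⟩ := minimizers_nonempty hL_diff.continuous hR hF
    obtain ⟨M, -, -, -, hgap⟩ := H.bounded_and_summable_gap (hdomS s hs) (hmin s hs)
    have hval : Tendsto (fun k => objective L R (x (K + (k + 1)))) atTop
        (𝓝 (objective L R s)) := by
      have h0 : Tendsto (fun k => 2 * τ * (L (x (K + (k + 1))) + (R (x (K + (k + 1)))).toReal) -
          2 * τ * (L s + (R s).toReal)) atTop (𝓝 0) := by
        refine squeeze_zero (fun k => sub_nonneg.2 (hmin s hs _ (H.mem (k + 1)))) (fun k => ?_)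
          hgap.tendsto_atTop_zero
        exact le_mul_of_one_le_left (sub_nonneg.2 (hmin s hs _ (H.mem (k + 1))))
          (one_le_inertiaT had _)
      have h1 := (h0.const_mul (2 * τ)⁻¹).add_const (L s + (R s).toReal)
      rw [mul_zero, zero_add] at h1
      rw [objective_eq_coe hR (hdomS s hs)]
      refine (EReal.tendsto_coe.2 h1).congr fun k => ?_
      rw [objective_eq_coe hR (H.mem (k + 1))]
      congr 1
      field_simp
      ring
    obtain ⟨u, hu, hlim⟩ := exists_tendsto_minimizer (X := fun k => x (K + (k + 1)))
      (lowerSemicontinuous_objective hL_diff.continuous hR) hs hval fun u hu => by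
        obtain ⟨l, hl⟩ := H.exists_tendsto_norm_sub (hdomS u hu) (hmin u hu)
        exact ⟨l, hl.comp (tendsto_add_atTop_nat 1)⟩
    refine ⟨u, hu, (tendsto_add_atTop_iff_nat (K + 1)).1 (hlim.congr fun k => ?_)⟩
    rw [show K + (k + 1) = k + (K + 1) by omega]

end Run

/-! ### Summability of the errors and conclusion. -/

theorem Summable.sq_of_nonneg {f : ℕ → ℝ} (hf : Summable f) (h0 : ∀ k, 0 ≤ f k) :
    Summable fun k => f k ^ 2 := by
  obtain ⟨M, hM⟩ := hf.tendsto_atTop_zero.bddAbove_range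
  refine Summable.of_nonneg_of_le (fun k => sq_nonneg _) (fun k => ?_) (hf.mul_left M)
  rw [sq]
  exact mul_le_mul_of_nonneg_right (hM ⟨k, rfl⟩) (h0 k)

theorem summable_inertiaT_mul {a d : ℝ} (had : AdmissibleInertia a d) {g : ℕ → ℝ}
    (hg : ∀ k, 0 ≤ g k) (h : Summable fun k : ℕ => (k : ℝ) ^ d * g k) :
    Summable fun k => inertiaT a d k * g k := by
  refine Summable.of_norm_bounded_eventually_nat (h.mul_left (((1 + a) / a) ^ d)) ?_
  filter_upwards [eventually_ge_atTop 1] with k hk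
  rw [Real.norm_of_nonneg (mul_nonneg (zero_le_one.trans (one_le_inertiaT had k)) (hg k)),
    ← mul_assoc]
  exact mul_le_mul_of_nonneg_right (inertiaT_le had hk) (hg k)

theorem summable_inertiaT_sq_mul {a d : ℝ} (had : AdmissibleInertia a d) {g : ℕ → ℝ}
    (hg : ∀ k, 0 ≤ g k) (h : Summable fun k : ℕ => (k : ℝ) ^ (2 * d) * g k) :
    Summable fun k => inertiaT a d k ^ 2 * g k := by
  refine Summable.of_norm_bounded_eventually_nat (h.mul_left ((((1 + a) / a) ^ d) ^ 2)) ?_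
  filter_upwards [eventually_ge_atTop 1] with k hk
  rw [Real.norm_of_nonneg (mul_nonneg (sq_nonneg _) (hg k)), ← mul_assoc,
    Real.rpow_two_mul_eq_sq k.cast_nonneg, ← mul_pow]
  exact mul_le_mul_of_nonneg_right
    (pow_le_pow_left₀ (zero_le_one.trans (one_le_inertiaT had k)) (inertiaT_le had hk) 2) (hg k)

theorem theorem2 {n nH : ℕ} (L : Euc n → ℝ) (R : Euc n → EReal) (β : ℝ≥0) (τ : ℝ)
    (hL_conv : ConvexOn ℝ Set.univ L) (hL_diff : Differentiable ℝ L)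
    (hL_lip : LipschitzWith β (∇ L)) (hR : ProperConvexLsc R)
    (hF : Coercive (objective L R))
    (hτ : 0 < τ) (hτβ : τ * β < 1)
    (Res : Euc n →ₗ[ℝ] Euc nH) (Pro : Euc nH →ₗ[ℝ] Euc n)
    (Φ : ℕ → ℕ → Euc nH → Euc nH) (m : ℕ) (τbar : ℕ → ℝ)
    (descent : ℕ → Prop) (p : ℕ)
    (a d : ℝ) (had : AdmissibleInertia a d)
    (ε : ℕ → ℝ) (hε : ∀ k, 0 ≤ ε k)
    (x y ybar : ℕ → Euc n)
    (hrun :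
      (IsIMLFISTA L τ (IsProxApprox₁ R τ) Res Pro Φ m τbar descent p a d ε x y ybar ∧
        Summable (fun k : ℕ => (k : ℝ) ^ d * √(ε k))) ∨
      (IsIMLFISTA L τ (IsProxApprox₂ R τ) Res Pro Φ m τbar descent p a d ε x y ybar ∧
        Summable (fun k : ℕ => (k : ℝ) ^ (2 * d) * ε k))) :
    (∀ k, 1 ≤ k → objective L R (x k) ≠ ⊤) ∧
    (∀ xstar ∈ minimizers (objective L R), objective L R xstar ≠ ⊤ ∧
      Memℓp (E := fun _ : ℕ => ℝ) (fun k : ℕ => (k : ℝ) ^ (2 * d) *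
        ((objective L R (x k)).toReal - (objective L R xstar).toReal)) ∞) ∧
    ∃ xstar ∈ minimizers (objective L R), Tendsto x atTop (𝓝 xstar) := by
  rcases hrun with ⟨hrun, hsum⟩ | ⟨hrun, hsum⟩
  · have hs := summable_inertiaT_mul had (fun k => Real.sqrt_nonneg (ε k)) hsum
    refine hrun.convergence (δ := fun k => √(2 / τ) * √(ε k)) (η := fun k => 2 * ε k)
      hL_conv hL_diff hL_lip hR hF hτ hτβ had (fun k => (hrun.forward_backward k).ne_top hR)
      (fun k v hv => (hrun.forward_backward k).subgradient_ineq hR hτ (hε k) hv)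
      (fun k => by positivity) (fun k => mul_nonneg zero_le_two (hε k)) ?_ ?_
    · exact (hs.mul_left √(2 / τ)).congr fun k => by ring
    -- For Type 1 the condition on `η` follows from the one on `δ`, since `t_k² ε_k = (t_k √ε_k)²`.
    · refine ((hs.sq_of_nonneg fun k => mul_nonneg (zero_le_one.trans (one_le_inertiaT had k))
        (Real.sqrt_nonneg _)).mul_left 2).congr fun k => ?_
      rw [mul_pow, Real.sq_sqrt (hε k)]
      ring
  · refine hrun.convergence (δ := fun _ => 0) (η := ε)
      hL_conv hL_diff hL_lip hR hF hτ hτβ had (fun k => (hrun.forward_backward k).ne_top hR)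
      (fun k v hv => ?_) (fun _ => le_rfl) hε (by simp)
      (summable_inertiaT_sq_mul had hε hsum)
    rw [zero_mul, add_zero]
    exact (hrun.forward_backward k).subgradient_ineq hR hv
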